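/- Let $\mathbb{D}=\{z\in\mathbb{C}:|z|<1\}$ and let $\psi$ be a Ma–Minda function, that is, $\psi$ is analytic and univalent in $\mathbb{D}$ with $\operatorname{Re}\psi(z)>0$ for $z\in\mathbb{D}$, $\psi(0)=1$, $\psi'(0)>0$, and $\psi(\mathbb{D})$ symmetric about the real axis. Let $\mathcal{S}^*(\psi)$ be the class of analytic functions $f$ in $\mathbb{D}$ with $f(0)=0$, $f'(0)=1$ and $zf'(z)/f(z)\prec\psi(z)$, where $\prec$ denotes subordination: $g\prec h$ if $g=h\circ w$ on $\mathbb{D}$ for some analytic $w:\mathbb{D}\to\mathbb{D}$ with $w(0)=0$. Put $$f_0(z)=z\exp\int_0^z\frac{\psi(t)-1}{t}\,dt\qquad(z\in\mathbb{D}).$$ Let $0<r<1$, and let $z_1,z_2$ be points of the circle $|z|=r$ such that $\min_{|z|=r}|\psi(z)|=|\psi(z_1)|$ and $\max_{|z|=r}|\psi(z)|=|\psi(z_2)|$. Then $f_0(r)$ and $f_0(-r)$ are real, and for every $f\in\mathcal{S}^*(\psi)$ and every $z_0$ with $|z_0|=r$, $$|\psi(z_1)|\left(\frac{-f_0(-r)}{r}\right)\le|f'(z_0)|\le\left(\frac{f_0(r)}{r}\right)|\psi(z_2)|.$$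 -/

import Mathlib

open Complex Metric Set

noncomputable section

/-- Ma–Minda functions: analytic and univalent on the open unit disk `𝔻`, with
`Re ψ > 0`, `ψ(0) = 1`, `ψ'(0) > 0` (a positive real number), and `ψ(𝔻)` symmetric
about the real axis. -/
structure IsMaMinda (ψ : ℂ → ℂ) : Prop where
  analytic : DifferentiableOn ℂ ψ (ball 0 1)
  univalent : InjOn ψ (ball 0 1)
  re_pos : ∀ z ∈ ball (0 : ℂ) 1, 0 < (ψ z).re
  map_zero : ψ 0 = 1
  deriv_zero_re : 0 < (deriv ψ 0).re
  deriv_zero_im : (deriv ψ 0).im = 0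
  symm : ∀ u ∈ ψ '' ball 0 1, (starRingEnd ℂ) u ∈ ψ '' ball 0 1

/-- The class `𝒜` of analytic functions `f(z) = z + a₂ z² + ⋯` on the open unit disk. -/
structure IsNormalizedAnalytic (f : ℂ → ℂ) : Prop where
  analytic : DifferentiableOn ℂ f (ball 0 1)
  map_zero : f 0 = 0
  deriv_zero : deriv f 0 = 1

/-- Subordination `g ≺ h` on the open unit disk: `g = h ∘ w` there, for an analytic self-map
`w` of the disk that fixes the origin. -/
def Subordinate (g h : ℂ → ℂ) : Prop :=
  ∃ w : ℂ → ℂ, DifferentiableOn ℂ w (ball 0 1) ∧ MapsTo w (ball 0 1) (ball 0 1) ∧ w 0 = 0 ∧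
    ∀ z ∈ ball (0 : ℂ) 1, g z = h (w z)

/-- The function `z f'(z) / f(z)`, with its removable singularity at the origin filled in
by the value `1` (which is the limit there for `f ∈ 𝒜`). -/
def starlikeQuotient (f : ℂ → ℂ) (z : ℂ) : ℂ :=
  if z = 0 then 1 else z * deriv f z / f z

/-- The class `𝒮*(ψ)`: functions `f ∈ 𝒜` with `z f'(z) / f(z) ≺ ψ(z)`. The nonvanishing of `f`
off the origin is what makes the quotient meaningful on the disk. -/
structure MaMindaStarlike (ψ f : ℂ → ℂ) : Prop where
  normalized : IsNormalizedAnalytic f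
  ne_zero : ∀ z ∈ ball (0 : ℂ) 1, z ≠ 0 → f z ≠ 0
  subordinate : Subordinate (starlikeQuotient f) ψ

/-- The function `f₀(z) = z exp ∫₀^z (ψ(t) - 1)/t dt`; the path of integration is the segment
`t = s z`, `0 ≤ s ≤ 1`. -/
def extremalStarlike (ψ : ℂ → ℂ) (z : ℂ) : ℂ :=
  z * Complex.exp (∫ s in (0 : ℝ)..1, (ψ (s * z) - 1) / (s * z) * z)

end

/-!
For `f ∈ 𝒮*(ψ)` the Schwarz lemma gives `f'(z) = (f(z) / z) ψ(ζ)` with `|ζ| ≤ |z|`. The maximum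
principle for `ψ` and `1 / ψ` bounds `|ψ(ζ)|` by its extreme values on the circle.

For `|f(z) / z|`, put `q(z) = f(z) / z`, so that `z q'(z) / q(z) = ψ(ζ) - 1`, and compare
`log |q(z)|` with `H(|z|)`, where `H(t) = log (f₀(t) / t)`. At a maximum of the difference off the
origin the angular derivative vanishes, so `ψ(ζ)` is real. As `ψ` is injective and commutes with
conjugation, `ζ` is then real, and `ψ` is increasing on `(-1, 1)`, so
`ψ(ζ) - 1 ≤ ψ(|z|) - 1 = |z| H'(|z|)`. Adding `ε t` to `H` makes this strict, which the radial
derivative at the maximum forbids. The lower bound is the same argument for `1 / q`.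
-/

open Filter Topology ComplexConjugate

section UnivalentInverse

variable {f g : ℂ → ℂ} {U : Set ℂ} {z : ℂ}

lemma not_eventually_eq_of_injOn (hU : U ∈ 𝓝 z) (hf : InjOn f U) :
    ¬ ∀ᶠ w in 𝓝 z, f w = f z := fun hconst => by
  obtain ⟨w, ⟨hw, hwU⟩, hwz⟩ :=
    (((hconst.and hU).filter_mono nhdsWithin_le_nhds).and eventually_mem_nhdsWithin :
      ∀ᶠ w in 𝓝[≠] z, (f w = f z ∧ w ∈ U) ∧ w ∈ ({z}ᶜ : Set ℂ)).exists
  exact hwz (hf hwU (mem_of_mem_nhds hU) hw)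

lemma isOpen_image_of_injOn (hU : IsOpen U) (hd : DifferentiableOn ℂ f U) (hf : InjOn f U) :
    IsOpen (f '' U) := by
  rw [isOpen_iff_mem_nhds]
  rintro _ ⟨z, hz, rfl⟩
  have hUz : U ∈ 𝓝 z := hU.mem_nhds hz
  exact (hd.analyticAt hUz).eventually_constant_or_nhds_le_map_nhds.resolve_left
    (not_eventually_eq_of_injOn hUz hf) (image_mem_map hUz)

lemma eventually_deriv_ne_zero_of_injOn (hU : U ∈ 𝓝 z) (hd : DifferentiableOn ℂ f U)
    (hf : InjOn f U) : ∀ᶠ w in 𝓝[≠] z, deriv f w ≠ 0 := by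
  have han : AnalyticAt ℂ f z := hd.analyticAt hU
  refine han.deriv.eventually_eq_zero_or_eventually_ne_zero.resolve_left fun hzero => ?_
  have horder := han.analyticOrderAt_deriv_add_one
  rw [analyticOrderAt_eq_top.2 hzero, top_add, eq_comm, analyticOrderAt_eq_top] at horder
  exact not_eventually_eq_of_injOn hU hf (horder.mono fun w hw => sub_eq_zero.1 hw)

lemma continuousOn_image_of_leftInvOn (hU : IsOpen U) (hd : DifferentiableOn ℂ f U)
    (hg : LeftInvOn g f U) : ContinuousOn g (f '' U) := by
  refine IsOpenMap.continuousOn_image_of_leftInvOn (fun V hV => ?_) hg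
  rw [domRestrict_eq, image_comp]
  have hVU : (↑) '' V ⊆ U := Subtype.coe_image_subset U V
  exact isOpen_image_of_injOn (hU.isOpenMap_subtype_val V hV) (hd.mono hVU)
    (hg.injOn.mono hVU)

/- Off the isolated zeros of `f'` this is the inverse function theorem; at the exceptional points
the continuous function `g` has a removable singularity. -/
theorem differentiableOn_image_of_leftInvOn (hU : IsOpen U) (hd : DifferentiableOn ℂ f U)
    (hg : LeftInvOn g f U) : DifferentiableOn ℂ g (f '' U) := by
  have himage : IsOpen (f '' U) := isOpen_image_of_injOn hU hd hg.injOn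
  have hcont : ∀ z ∈ U, ContinuousAt g (f z) := fun z hz =>
    (continuousOn_image_of_leftInvOn hU hd hg).continuousAt
      (himage.mem_nhds (mem_image_of_mem f hz))
  have hright : ∀ u ∈ f '' U, f (g u) = u := by
    rintro _ ⟨z, hz, rfl⟩
    rw [hg hz]
  have hregular : ∀ z ∈ U, deriv f z ≠ 0 → DifferentiableAt ℂ g (f z) := fun z hz hne => by
    refine (HasDerivAt.of_local_left_inverse (hcont z hz) ?_ hne
      (eventually_of_mem (himage.mem_nhds (mem_image_of_mem f hz)) hright)).differentiableAt
    rw [hg hz]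
    exact (hd.differentiableAt (hU.mem_nhds hz)).hasDerivAt
  rintro _ ⟨z, hz, rfl⟩
  have hpunctured : Tendsto g (𝓝[≠] (f z)) (𝓝[≠] z) := by
    have hlim : Tendsto g (𝓝 (f z)) (𝓝 z) := by simpa only [hg hz] using (hcont z hz).tendsto
    refine tendsto_nhdsWithin_iff.2 ⟨hlim.mono_left nhdsWithin_le_nhds, ?_⟩
    filter_upwards [nhdsWithin_le_nhds (himage.mem_nhds (mem_image_of_mem f hz)),
      self_mem_nhdsWithin] with v hv hvz hgv
    exact hvz (by rw [mem_singleton_iff, ← hright v hv, mem_singleton_iff.1 hgv])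
  refine (analyticAt_of_differentiable_on_punctured_nhds_of_continuousAt ?_
    (hcont z hz)).differentiableAt.differentiableWithinAt
  filter_upwards [hpunctured.eventually
      (eventually_deriv_ne_zero_of_injOn (hU.mem_nhds hz) hd hg.injOn),
    nhdsWithin_le_nhds (himage.mem_nhds (mem_image_of_mem f hz))] with v hne hv
  obtain ⟨y, hy, rfl⟩ := hv
  rw [hg hy] at hne
  exact hregular y hy hne

end UnivalentInverse

section Subordination

variable {g h : ℂ → ℂ}

theorem subordinate_of_mapsTo_image (hg : DifferentiableOn ℂ g (ball 0 1))
    (hh : DifferentiableOn ℂ h (ball 0 1)) (hinj : InjOn h (ball 0 1)) (h0 : g 0 = h 0)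
    (hmaps : MapsTo g (ball 0 1) (h '' ball 0 1)) : Subordinate g h := by
  have hleft := hinj.leftInvOn_invFunOn
  refine ⟨Function.invFunOn h (ball 0 1) ∘ g,
    (differentiableOn_image_of_leftInvOn isOpen_ball hh hleft).comp hg hmaps,
    fun z hz => Function.invFunOn_mem (hmaps hz), ?_,
    fun z hz => (Function.invFunOn_eq (hmaps hz)).symm⟩
  rw [Function.comp_apply, h0, hleft (mem_ball_self one_pos)]

namespace Subordinate

theorem exists_norm_le (hgh : Subordinate g h) {z : ℂ} (hz : z ∈ ball (0 : ℂ) 1) :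
    ∃ ζ : ℂ, ‖ζ‖ ≤ ‖z‖ ∧ g z = h ζ := by
  obtain ⟨w, hw, hmaps, hw0, heq⟩ := hgh
  exact ⟨w z, norm_le_norm_of_mapsTo_ball hw (hmaps.mono_right ball_subset_closedBall) hw0
    (mem_ball_zero_iff.1 hz), heq z hz⟩

theorem eqOn_of_deriv_eq (hgh : Subordinate g h) (hderiv : deriv g 0 = deriv h 0)
    (hne : deriv h 0 ≠ 0) : EqOn g h (ball 0 1) := by
  obtain ⟨w, hw, hmaps, hw0, heq⟩ := hgh
  have hball : ball (0 : ℂ) 1 ∈ 𝓝 0 := ball_mem_nhds 0 one_pos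
  have hderiv_w : deriv w 0 = 1 := by
    have hchain : deriv (h ∘ w) 0 = deriv h (w 0) * deriv w 0 :=
      deriv_comp 0 (by rw [hw0]; exact differentiableAt_of_deriv_ne_zero hne)
        (hw.differentiableAt hball)
    have hgw : g =ᶠ[𝓝 0] h ∘ w := eventually_of_mem hball heq
    rw [← hgw.deriv_eq, hderiv, hw0] at hchain
    exact mul_left_cancel₀ hne (hchain.symm.trans (mul_one _).symm)
  have hid := affine_of_mapsTo_ball_of_norm_dslope_eq_div hw
    (by rw [hw0]; exact hmaps.mono_right ball_subset_closedBall) (mem_ball_self one_pos)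
    (by simp [hderiv_w])
  intro z hz
  have hwz : w z = z := by simpa [hw0, hderiv_w] using hid hz
  rw [heq z hz, hwz]

end Subordinate

end Subordination

section ModulusPrinciples

variable {E : Type*} [NormedAddCommGroup E] [NormedSpace ℂ E] [Nontrivial E] {f : E → ℂ}

theorem le_norm_of_forall_mem_frontier_le_norm {U : Set E} (hU : Bornology.IsBounded U)
    (hf : DiffContOnCl ℂ f U) (hne : ∀ z ∈ closure U, f z ≠ 0) {C : ℝ}
    (hC : ∀ z ∈ frontier U, C ≤ ‖f z‖) {z : E} (hz : z ∈ closure U) : C ≤ ‖f z‖ := by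
  rcases le_or_gt C 0 with hC0 | hC0
  · exact hC0.trans (norm_nonneg _)
  have hinv : ‖(f z)⁻¹‖ ≤ C⁻¹ :=
    norm_le_of_forall_mem_frontier_norm_le hU (hf.inv hne)
      (fun ζ hζ => by
        rw [Pi.inv_apply, norm_inv]
        exact inv_anti₀ hC0 (hC ζ hζ)) hz
  rwa [norm_inv, inv_le_inv₀ (norm_pos_iff.2 (hne z hz)) hC0] at hinv

end ModulusPrinciples

section RadialComparison

lemma nonneg_of_isMaxOn_Icc_right {φ : ℝ → ℝ} {φ' a b : ℝ} (hab : a < b)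
    (hφ : HasDerivWithinAt φ φ' (Icc a b) b) (hmax : IsMaxOn φ (Icc a b) b) : 0 ≤ φ' := by
  have htangent : a - b ∈ posTangentConeAt (Icc a b) b :=
    sub_mem_posTangentConeAt_of_segment_subset (by rw [segment_symm, segment_eq_Icc hab.le])
  have hnonpos := hmax.localize.hasFDerivWithinAt_nonpos hφ.hasFDerivWithinAt htangent
  simp only [ContinuousLinearMap.toSpanSingleton_apply, smul_eq_mul] at hnonpos
  nlinarith

lemma hasDerivAt_log_norm {γ : ℝ → ℂ} {γ' : ℂ} {t : ℝ} (hγ : HasDerivAt γ γ' t)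
    (hne : γ t ≠ 0) : HasDerivAt (fun s => Real.log ‖γ s‖) (γ' / γ t).re t := by
  have hsq := (hγ.norm_sq.log (by positivity)).div_const 2
  convert! hsq using 1
  · funext s
    simp
  · rw [Complex.inner, div_re, normSq_eq_norm_sq]
    simp
    field_simp

variable {q : ℂ → ℂ} {z : ℂ}

lemma hasDerivAt_log_norm_comp (hq : DifferentiableAt ℂ q z) (hqz : q z ≠ 0) {γ : ℝ → ℂ}
    {γ' : ℂ} {t : ℝ} (hγ : HasDerivAt γ γ' t) (hγt : γ t = z) :
    HasDerivAt (fun s => Real.log ‖q (γ s)‖) (γ' * logDeriv q z).re t := by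
  subst hγt
  rw [logDeriv_apply, mul_div_assoc', mul_comm]
  exact hasDerivAt_log_norm (hq.hasDerivAt.comp t hγ) hqz

lemma im_mul_logDeriv_eq_zero_of_isMaxOn_sphere (hq : DifferentiableAt ℂ q z) (hqz : q z ≠ 0)
    (hmax : IsMaxOn (fun ζ => Real.log ‖q ζ‖) (sphere 0 ‖z‖) z) :
    (z * logDeriv q z).im = 0 := by
  have hrotation : HasDerivAt (fun θ : ℝ => z * cexp (θ * I)) (z * I) 0 := by
    have harg : HasDerivAt (fun θ : ℝ => (θ : ℂ) * I) I 0 := by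
      simpa using (hasDerivAt_id (0 : ℝ)).ofReal_comp.mul_const I
    simpa using harg.cexp.const_mul z
  have hlocal : IsLocalMax (fun θ : ℝ => Real.log ‖q (z * cexp (θ * I))‖) 0 :=
    Eventually.of_forall fun θ => by
      have hmem : z * cexp (θ * I) ∈ sphere (0 : ℂ) ‖z‖ := by simp [norm_exp_ofReal_mul_I]
      simpa using hmax hmem
  have hzero := hlocal.hasDerivAt_eq_zero (hasDerivAt_log_norm_comp hq hqz hrotation (by simp))
  rwa [mul_right_comm, mul_I_re, neg_eq_zero] at hzero

lemma mul_le_re_mul_logDeriv_of_isMaxOn_closedBall {H : ℝ → ℝ} {H' : ℝ}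
    (hq : DifferentiableAt ℂ q z) (hqz : q z ≠ 0) (hH : HasDerivAt H H' ‖z‖)
    (hmax : IsMaxOn (fun ζ => Real.log ‖q ζ‖ - H ‖ζ‖) (closedBall 0 ‖z‖) z) :
    ‖z‖ * H' ≤ (z * logDeriv q z).re := by
  have hray : HasDerivAt (fun s : ℝ => (s : ℂ) * z) z 1 := by
    simpa using (hasDerivAt_id (1 : ℝ)).ofReal_comp.mul_const z
  have hradius : HasDerivAt (fun s : ℝ => H (s * ‖z‖)) (H' * ‖z‖) 1 := by
    refine HasDerivAt.comp (1 : ℝ) (by rwa [one_mul]) ?_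
    simpa using (hasDerivAt_id (1 : ℝ)).mul_const ‖z‖
  have hderiv := (hasDerivAt_log_norm_comp hq hqz hray (by simp)).sub hradius
  have hmax_ray : IsMaxOn (fun s : ℝ => Real.log ‖q (s * z)‖ - H (s * ‖z‖)) (Icc 0 1) 1 := by
    intro s hs
    have hnorm : ‖(s : ℂ) * z‖ = s * ‖z‖ := by rw [norm_mul, norm_real, Real.norm_of_nonneg hs.1]
    have hmem : (s : ℂ) * z ∈ closedBall (0 : ℂ) ‖z‖ := by
      rw [mem_closedBall_zero_iff, hnorm]
      exact mul_le_of_le_one_left (norm_nonneg z) hs.2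
    simpa [abs_of_nonneg hs.1] using hmax hmem
  linarith [nonneg_of_isMaxOn_Icc_right one_pos hderiv.hasDerivWithinAt hmax_ray]

variable {H H' : ℝ → ℝ} {R : ℝ}

lemma log_norm_le_of_re_mul_logDeriv_lt (hq : DifferentiableOn ℂ q (ball 0 R))
    (hne : ∀ ζ ∈ ball (0 : ℂ) R, q ζ ≠ 0) (hq0 : Real.log ‖q 0‖ ≤ H 0)
    (hHc : ContinuousOn H (Ico 0 R)) (hH : ∀ t ∈ Ioo 0 R, HasDerivAt H (H' t) t)
    (hlt : ∀ ζ ∈ ball (0 : ℂ) R, ζ ≠ 0 → (ζ * logDeriv q ζ).im = 0 →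
      (ζ * logDeriv q ζ).re < ‖ζ‖ * H' ‖ζ‖)
    (hz : z ∈ ball (0 : ℂ) R) : Real.log ‖q z‖ ≤ H ‖z‖ := by
  have hzR : ‖z‖ < R := mem_ball_zero_iff.1 hz
  have hsub : closedBall (0 : ℂ) ‖z‖ ⊆ ball 0 R := closedBall_subset_ball hzR
  have hcont : ContinuousOn (fun ζ => Real.log ‖q ζ‖ - H ‖ζ‖) (closedBall 0 ‖z‖) := by
    refine ContinuousOn.sub ?_ (hHc.comp continuous_norm.continuousOn fun ζ hζ =>
      ⟨norm_nonneg ζ, mem_ball_zero_iff.1 (hsub hζ)⟩)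
    exact (hq.continuousOn.mono hsub).norm.log fun ζ hζ => norm_ne_zero_iff.2 (hne ζ (hsub hζ))
  obtain ⟨ζ, hζ, hmax⟩ := (isCompact_closedBall (0 : ℂ) ‖z‖).exists_isMaxOn
    ⟨z, by simp⟩ hcont
  have hζ0 : ζ = 0 := by
    by_contra hζ0
    have hζR := hsub hζ
    have hqζ := hq.differentiableAt (isOpen_ball.mem_nhds hζR)
    have hmaxζ := hmax.on_subset (closedBall_subset_closedBall (mem_closedBall_zero_iff.1 hζ))
    have hmax_sphere : IsMaxOn (fun ξ => Real.log ‖q ξ‖) (sphere 0 ‖ζ‖) ζ := fun ξ hξ => by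
      simpa [mem_sphere_zero_iff_norm.1 hξ] using hmaxζ (sphere_subset_closedBall hξ)
    have hreal := im_mul_logDeriv_eq_zero_of_isMaxOn_sphere hqζ (hne ζ hζR) hmax_sphere
    exact (hlt ζ hζR hζ0 hreal).not_ge (mul_le_re_mul_logDeriv_of_isMaxOn_closedBall hqζ
      (hne ζ hζR) (hH ‖ζ‖ ⟨norm_pos_iff.2 hζ0, mem_ball_zero_iff.1 hζR⟩) hmaxζ)
  have hle : Real.log ‖q z‖ - H ‖z‖ ≤ Real.log ‖q ζ‖ - H ‖ζ‖ := hmax (by simp)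
  rw [hζ0, norm_zero] at hle
  linarith

theorem log_norm_le_of_re_mul_logDeriv_le (hq : DifferentiableOn ℂ q (ball 0 R))
    (hne : ∀ ζ ∈ ball (0 : ℂ) R, q ζ ≠ 0) (hq0 : Real.log ‖q 0‖ ≤ H 0)
    (hHc : ContinuousOn H (Ico 0 R)) (hH : ∀ t ∈ Ioo 0 R, HasDerivAt H (H' t) t)
    (hle : ∀ ζ ∈ ball (0 : ℂ) R, ζ ≠ 0 → (ζ * logDeriv q ζ).im = 0 →
      (ζ * logDeriv q ζ).re ≤ ‖ζ‖ * H' ‖ζ‖)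
    (hz : z ∈ ball (0 : ℂ) R) : Real.log ‖q z‖ ≤ H ‖z‖ := by
  have hperturbed : ∀ ε > 0, Real.log ‖q z‖ ≤ H ‖z‖ + ε * ‖z‖ := fun ε hε => by
    refine log_norm_le_of_re_mul_logDeriv_lt (H := fun t => H t + ε * t)
      (H' := fun t => H' t + ε) hq hne (by simpa using hq0) (hHc.add (by fun_prop))
      (fun t ht => (hH t ht).add (by simpa using (hasDerivAt_id t).const_mul ε))
      (fun ζ hζ hζ0 hreal => ?_) hz
    have := mul_pos (norm_pos_iff.2 hζ0) hε
    linarith [hle ζ hζ hζ0 hreal]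
  have hlim : Tendsto (fun ε : ℝ => H ‖z‖ + ε * ‖z‖) (𝓝[>] 0) (𝓝 (H ‖z‖)) := by
    refine Tendsto.mono_left (Continuous.tendsto' (by fun_prop) _ _ (by simp)) nhdsWithin_le_nhds
  exact ge_of_tendsto hlim (eventually_mem_nhdsWithin.mono hperturbed)

end RadialComparison

lemma ofReal_mem_unitBall {x : ℝ} (hx : x ∈ Ioo (-1) 1) : (x : ℂ) ∈ ball (0 : ℂ) 1 := by
  simpa [abs_lt] using hx

/-- The exponent `∫₀ˣ (ψ(t) - 1) / t dt` of `f₀(x)` at a real point `x`, for `ψ` real on the real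
axis with `ψ(0) = 1`; writing the integrand as `dslope ψ 0` fills in its removable singularity. -/
noncomputable def extremalExponent (ψ : ℂ → ℂ) (x : ℝ) : ℝ :=
  ∫ t in (0 : ℝ)..x, (dslope ψ 0 t).re

namespace IsMaMinda

variable {ψ : ℂ → ℂ}

lemma differentiableAt (hψ : IsMaMinda ψ) {z : ℂ} (hz : z ∈ ball (0 : ℂ) 1) :
    DifferentiableAt ℂ ψ z :=
  hψ.analytic.differentiableAt (isOpen_ball.mem_nhds hz)

lemma ne_zero (hψ : IsMaMinda ψ) {z : ℂ} (hz : z ∈ ball (0 : ℂ) 1) : ψ z ≠ 0 := fun hzero => by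
  simpa [hzero] using hψ.re_pos z hz

/- The reflection `conj ∘ ψ ∘ conj` is subordinate to `ψ` because they have the same range, and it
has the same derivative at the origin. -/
theorem map_conj (hψ : IsMaMinda ψ) {z : ℂ} (hz : z ∈ ball (0 : ℂ) 1) :
    ψ (conj z) = conj (ψ z) := by
  have hconj : ∀ ζ ∈ ball (0 : ℂ) 1, conj ζ ∈ ball (0 : ℂ) 1 := by simp
  have hdiff : ∀ ζ ∈ ball (0 : ℂ) 1, DifferentiableAt ℂ (conj ∘ ψ ∘ conj) ζ := fun ζ hζ =>
    differentiableAt_conj_conj_iff.2 (hψ.differentiableAt (hconj ζ hζ))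
  have hsub : Subordinate (conj ∘ ψ ∘ conj) ψ :=
    subordinate_of_mapsTo_image (fun ζ hζ => (hdiff ζ hζ).differentiableWithinAt) hψ.analytic
      hψ.univalent (by simp [hψ.map_zero])
      fun ζ hζ => hψ.symm _ (mem_image_of_mem ψ (hconj ζ hζ))
  have hderiv : deriv (conj ∘ ψ ∘ conj) 0 = deriv ψ 0 := by
    rw [deriv_conj_conj, Function.comp_apply, Function.comp_apply, RingHom.map_zero,
      conj_eq_iff_im.2 hψ.deriv_zero_im]
  have hne : deriv ψ 0 ≠ 0 := fun hzero => by simpa [hzero] using hψ.deriv_zero_re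
  have heq : conj (ψ (conj z)) = ψ z := hsub.eqOn_of_deriv_eq hderiv hne hz
  rw [← heq, conj_conj]

lemma im_eq_zero_iff (hψ : IsMaMinda ψ) {z : ℂ} (hz : z ∈ ball (0 : ℂ) 1) :
    (ψ z).im = 0 ↔ z.im = 0 := by
  rw [← conj_eq_iff_im, ← conj_eq_iff_im, ← hψ.map_conj hz]
  exact hψ.univalent.eq_iff (by simpa using hz) hz

lemma im_ofReal (hψ : IsMaMinda ψ) {x : ℝ} (hx : x ∈ Ioo (-1) 1) : (ψ x).im = 0 :=
  (hψ.im_eq_zero_iff (ofReal_mem_unitBall hx)).2 (ofReal_im x)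

theorem strictMonoOn_re (hψ : IsMaMinda ψ) :
    StrictMonoOn (fun x : ℝ => (ψ x).re) (Ioo (-1) 1) := by
  have hcont : ContinuousOn (fun x : ℝ => (ψ x).re) (Ioo (-1) 1) :=
    continuous_re.comp_continuousOn (hψ.analytic.continuousOn.comp
      continuous_ofReal.continuousOn fun _ => ofReal_mem_unitBall)
  have hinj : InjOn (fun x : ℝ => (ψ x).re) (Ioo (-1) 1) := fun x hx y hy hxy =>
    ofReal_injective (hψ.univalent (ofReal_mem_unitBall hx) (ofReal_mem_unitBall hy)
      (Complex.ext hxy (by rw [hψ.im_ofReal hx, hψ.im_ofReal hy])))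
  refine (hcont.strictMonoOn_of_injOn_Ioo (by norm_num) hinj).resolve_right fun hanti => ?_
  have hderiv : HasDerivAt (fun x : ℝ => (ψ x).re) (deriv ψ 0).re 0 :=
    HasDerivAt.real_of_complex (hψ.differentiableAt (by simp)).hasDerivAt
  have hnonpos : derivWithin (fun x : ℝ => (ψ x).re) (Ioo (-1) 1) 0 ≤ 0 :=
    hanti.antitoneOn.derivWithin_nonpos
  rw [derivWithin_of_isOpen isOpen_Ioo (by norm_num), hderiv.deriv] at hnonpos
  exact hψ.deriv_zero_re.not_ge hnonpos

theorem re_mem_Icc_of_im_eq_zero (hψ : IsMaMinda ψ) {z : ℂ} {t : ℝ} (ht : t < 1)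
    (hz : ‖z‖ ≤ t) (him : (ψ z).im = 0) :
    (ψ z).re ∈ Icc (ψ (-t : ℝ)).re (ψ t).re := by
  have hzim : z.im = 0 := (hψ.im_eq_zero_iff (by simpa using hz.trans_lt ht)).1 him
  obtain ⟨x, rfl⟩ : ∃ x : ℝ, (x : ℂ) = z := ⟨z.re, Complex.ext rfl hzim.symm⟩
  obtain ⟨hlower, hupper⟩ := abs_le.1 (norm_real x ▸ hz)
  have hmono := hψ.strictMonoOn_re.monotoneOn
  exact ⟨hmono ⟨by linarith, by linarith⟩ ⟨by linarith, by linarith⟩ hlower,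
    hmono ⟨by linarith, by linarith⟩ ⟨by linarith, by linarith⟩ hupper⟩

lemma mul_dslope (hψ : IsMaMinda ψ) (z : ℂ) : z * dslope ψ 0 z = ψ z - 1 := by
  simpa [hψ.map_zero] using sub_smul_dslope ψ 0 z

lemma mul_re_dslope (hψ : IsMaMinda ψ) (x : ℝ) : x * (dslope ψ 0 x).re = (ψ x).re - 1 := by
  simpa using congrArg re (hψ.mul_dslope x)

lemma im_dslope_ofReal (hψ : IsMaMinda ψ) {x : ℝ} (hx : x ∈ Ioo (-1) 1) :
    (dslope ψ 0 x).im = 0 := by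
  rcases eq_or_ne x 0 with rfl | hx0
  · simpa using hψ.deriv_zero_im
  · simpa [hψ.im_ofReal hx, hx0] using congrArg im (hψ.mul_dslope x)

lemma continuousOn_re_dslope (hψ : IsMaMinda ψ) :
    ContinuousOn (fun t : ℝ => (dslope ψ 0 t).re) (Ioo (-1) 1) := by
  have hdiff : DifferentiableOn ℂ (dslope ψ 0) (ball 0 1) :=
    (differentiableOn_dslope (ball_mem_nhds 0 one_pos)).2 hψ.analytic
  exact continuous_re.comp_continuousOn (hdiff.continuousOn.comp
    continuous_ofReal.continuousOn fun _ => ofReal_mem_unitBall)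

lemma hasDerivAt_extremalExponent (hψ : IsMaMinda ψ) {x : ℝ} (hx : x ∈ Ioo (-1) 1) :
    HasDerivAt (extremalExponent ψ) (dslope ψ 0 x).re x := by
  have hsub : uIcc 0 x ⊆ Ioo (-1 : ℝ) 1 := ordConnected_Ioo.uIcc_subset (by norm_num) hx
  exact intervalIntegral.integral_hasDerivAt_right
    (hψ.continuousOn_re_dslope.mono hsub).intervalIntegrable
    (hψ.continuousOn_re_dslope.stronglyMeasurableAtFilter isOpen_Ioo x hx)
    (hψ.continuousOn_re_dslope.continuousAt (isOpen_Ioo.mem_nhds hx))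

theorem extremalStarlike_ofReal (hψ : IsMaMinda ψ) {x : ℝ} (hx : x ∈ Ioo (-1) 1) :
    extremalStarlike ψ x = (x * Real.exp (extremalExponent ψ x) : ℝ) := by
  rcases eq_or_ne x 0 with rfl | hx0
  · simp [extremalStarlike]
  have hintegrand : ∀ s ∈ Ioo (0 : ℝ) 1,
      (ψ (s * x) - 1) / (s * x) * x = ((x * (dslope ψ 0 (x * s : ℝ)).re : ℝ) : ℂ) := by
    intro s hs
    have hxs : x * s ∈ Ioo (-1 : ℝ) 1 := by
      rw [mem_Ioo, ← abs_lt, abs_mul, abs_of_pos hs.1]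
      exact mul_lt_one_of_nonneg_of_lt_one_left (abs_nonneg x) (abs_lt.2 hx) hs.2.le
    have hreal : (((dslope ψ 0 (x * s : ℝ)).re : ℝ) : ℂ) = dslope ψ 0 (x * s : ℝ) :=
      Complex.ext rfl (hψ.im_dslope_ofReal hxs).symm
    have hne : (s : ℂ) * x ≠ 0 := by exact_mod_cast mul_ne_zero hs.1.ne' hx0
    rw [ofReal_mul, hreal, ofReal_mul, mul_comm (x : ℂ) (s : ℂ), ← hψ.mul_dslope,
      mul_div_cancel_left₀ _ hne, mul_comm]
  have hintegral : ∫ s in (0 : ℝ)..1, (ψ (s * x) - 1) / (s * x) * x = extremalExponent ψ x := by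
    rw [intervalIntegral.integral_congr_Ioo_of_le zero_le_one hintegrand,
      intervalIntegral.integral_ofReal, intervalIntegral.integral_const_mul,
      intervalIntegral.mul_integral_comp_mul_left (f := fun t : ℝ => (dslope ψ 0 t).re),
      mul_zero, mul_one, extremalExponent]
  rw [extremalStarlike, hintegral, ofReal_mul, ofReal_exp]

lemma diffContOnCl_ball (hψ : IsMaMinda ψ) {r : ℝ} (hr : r < 1) :
    DiffContOnCl ℂ ψ (ball 0 r) :=
  (hψ.analytic.mono (closedBall_subset_ball hr)).diffContOnCl_ball subset_rfl

theorem norm_le_of_isMaxOn_sphere (hψ : IsMaMinda ψ) {r : ℝ} (hr0 : 0 < r) (hr1 : r < 1)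
    {z₀ z : ℂ} (hmax : IsMaxOn (fun ζ => ‖ψ ζ‖) (sphere 0 r) z₀) (hz : ‖z‖ ≤ r) :
    ‖ψ z‖ ≤ ‖ψ z₀‖ := by
  refine norm_le_of_forall_mem_frontier_norm_le isBounded_ball (hψ.diffContOnCl_ball hr1) ?_ ?_
  · rw [frontier_ball 0 hr0.ne']
    exact hmax
  · rwa [closure_ball 0 hr0.ne', mem_closedBall_zero_iff]

theorem norm_le_of_isMinOn_sphere (hψ : IsMaMinda ψ) {r : ℝ} (hr0 : 0 < r) (hr1 : r < 1)
    {z₀ z : ℂ} (hmin : IsMinOn (fun ζ => ‖ψ ζ‖) (sphere 0 r) z₀) (hz : ‖z‖ ≤ r) :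
    ‖ψ z₀‖ ≤ ‖ψ z‖ := by
  refine le_norm_of_forall_mem_frontier_le_norm isBounded_ball (hψ.diffContOnCl_ball hr1)
    ?_ ?_ ?_
  · rw [closure_ball 0 hr0.ne']
    exact fun ζ hζ => hψ.ne_zero (closedBall_subset_ball hr1 hζ)
  · rw [frontier_ball 0 hr0.ne']
    exact hmin
  · rwa [closure_ball 0 hr0.ne', mem_closedBall_zero_iff]

end IsMaMinda

lemma mul_logDeriv_dslope {f : ℂ → ℂ} {z : ℂ} (hf : DifferentiableAt ℂ f z) (hf0 : f 0 = 0)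
    (hfz : f z ≠ 0) : z * logDeriv (dslope f 0) z = z * deriv f z / f z - 1 := by
  have hz0 : z ≠ 0 := by
    rintro rfl
    exact hfz hf0
  have hquot : dslope f 0 =ᶠ[𝓝 z] fun ζ => f ζ / ζ := by
    filter_upwards [isOpen_ne.mem_nhds hz0] with ζ hζ
    rw [dslope_of_ne f hζ, slope_def_field, hf0, sub_zero, sub_zero]
  rw [(logDeriv_congr_nhds hquot).eq_of_nhds, logDeriv_div (g := fun ζ => ζ) z hfz hz0 hf
    differentiableAt_fun_id, logDeriv_id', logDeriv_apply]
  field_simp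

namespace MaMindaStarlike

variable {ψ f : ℂ → ℂ}

lemma dslope_ne_zero (hf : MaMindaStarlike ψ f) {z : ℂ} (hz : z ∈ ball (0 : ℂ) 1) :
    dslope f 0 z ≠ 0 := by
  rcases eq_or_ne z 0 with rfl | hz0
  · simp [hf.normalized.deriv_zero]
  · simpa [dslope_of_ne f hz0, slope_def_field, hf.normalized.map_zero, hz0]
      using hf.ne_zero z hz hz0

lemma differentiableOn_dslope (hf : MaMindaStarlike ψ f) :
    DifferentiableOn ℂ (dslope f 0) (ball 0 1) :=
  (Complex.differentiableOn_dslope (ball_mem_nhds 0 one_pos)).2 hf.normalized.analytic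

lemma exists_norm_le_mul_deriv_div_eq (hf : MaMindaStarlike ψ f) {z : ℂ}
    (hz : z ∈ ball (0 : ℂ) 1) (hz0 : z ≠ 0) :
    ∃ ζ : ℂ, ‖ζ‖ ≤ ‖z‖ ∧ z * deriv f z / f z = ψ ζ := by
  simpa only [starlikeQuotient, if_neg hz0] using hf.subordinate.exists_norm_le hz

lemma re_mul_logDeriv_mem_Icc (hψ : IsMaMinda ψ) (hf : MaMindaStarlike ψ f) {z : ℂ}
    (hz : z ∈ ball (0 : ℂ) 1) (hz0 : z ≠ 0) (him : (z * logDeriv (dslope f 0) z).im = 0) :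
    (z * logDeriv (dslope f 0) z).re ∈
      Icc (-‖z‖ * (dslope ψ 0 (-‖z‖ : ℝ)).re) (‖z‖ * (dslope ψ 0 ‖z‖).re) := by
  obtain ⟨ζ, hζ, hquot⟩ := hf.exists_norm_le_mul_deriv_div_eq hz hz0
  rw [mul_logDeriv_dslope (hf.normalized.analytic.differentiableAt (isOpen_ball.mem_nhds hz))
    hf.normalized.map_zero (hf.ne_zero z hz hz0), hquot] at him ⊢
  obtain ⟨hlower, hupper⟩ :=
    hψ.re_mem_Icc_of_im_eq_zero (mem_ball_zero_iff.1 hz) hζ (by simpa using him)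
  rw [hψ.mul_re_dslope, hψ.mul_re_dslope, sub_re, one_re]
  exact ⟨sub_le_sub_right hlower 1, sub_le_sub_right hupper 1⟩

theorem log_norm_dslope_le (hψ : IsMaMinda ψ) (hf : MaMindaStarlike ψ f) {z : ℂ}
    (hz : z ∈ ball (0 : ℂ) 1) : Real.log ‖dslope f 0 z‖ ≤ extremalExponent ψ ‖z‖ := by
  have hderiv : ∀ t ∈ Ico (0 : ℝ) 1, HasDerivAt (extremalExponent ψ) (dslope ψ 0 t).re t :=
    fun t ht => hψ.hasDerivAt_extremalExponent ⟨by linarith [ht.1], ht.2⟩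
  exact log_norm_le_of_re_mul_logDeriv_le hf.differentiableOn_dslope
    (fun ζ hζ => hf.dslope_ne_zero hζ) (by simp [hf.normalized.deriv_zero, extremalExponent])
    (HasDerivAt.continuousOn hderiv) (fun t ht => hderiv t (Ioo_subset_Ico_self ht))
    (fun ζ hζ hζ0 him => (hf.re_mul_logDeriv_mem_Icc hψ hζ hζ0 him).2) hz

theorem le_log_norm_dslope (hψ : IsMaMinda ψ) (hf : MaMindaStarlike ψ f) {z : ℂ}
    (hz : z ∈ ball (0 : ℂ) 1) : extremalExponent ψ (-‖z‖) ≤ Real.log ‖dslope f 0 z‖ := by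
  have hderiv : ∀ t ∈ Ico (0 : ℝ) 1,
      HasDerivAt (fun t => -extremalExponent ψ (-t)) (dslope ψ 0 (-t : ℝ)).re t := fun t ht => by
    have hneg : -t ∈ Ioo (-1 : ℝ) 1 := ⟨by linarith [ht.2], by linarith [ht.1]⟩
    simpa [Function.comp_def] using
      ((hψ.hasDerivAt_extremalExponent hneg).comp t (hasDerivAt_neg t)).fun_neg
  have hinv : Real.log ‖(dslope f 0)⁻¹ z‖ ≤ -extremalExponent ψ (-‖z‖) := by
    refine log_norm_le_of_re_mul_logDeriv_le
      (hf.differentiableOn_dslope.inv fun ζ hζ => hf.dslope_ne_zero hζ)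
      (fun ζ hζ => inv_ne_zero (hf.dslope_ne_zero hζ))
      (by simp [hf.normalized.deriv_zero, extremalExponent])
      (HasDerivAt.continuousOn hderiv) (fun t ht => hderiv t (Ioo_subset_Ico_self ht))
      (fun ζ hζ hζ0 him => ?_) hz
    have hlogDeriv : logDeriv (dslope f 0)⁻¹ ζ = -logDeriv (dslope f 0) ζ := by
      simpa [Pi.inv_def] using logDeriv_fun_zpow
        (hf.differentiableOn_dslope.differentiableAt (isOpen_ball.mem_nhds hζ)) (-1)
    rw [hlogDeriv, mul_neg] at him ⊢
    rw [neg_im, neg_eq_zero] at him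
    linarith [neg_re (ζ * logDeriv (dslope f 0) ζ),
      (hf.re_mul_logDeriv_mem_Icc hψ hζ hζ0 him).1]
  rwa [Pi.inv_apply, norm_inv, Real.log_inv, neg_le_neg_iff] at hinv

theorem norm_mem_Icc_extremalStarlike (hψ : IsMaMinda ψ) (hf : MaMindaStarlike ψ f)
    {z : ℂ} (hz : z ∈ ball (0 : ℂ) 1) :
    ‖f z‖ ∈ Icc (-(extremalStarlike ψ (-‖z‖ : ℝ)).re) (extremalStarlike ψ ‖z‖).re := by
  have hz1 : ‖z‖ < 1 := mem_ball_zero_iff.1 hz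
  have hnonneg : 0 ≤ ‖z‖ := norm_nonneg z
  have hfz : ‖f z‖ = ‖z‖ * ‖dslope f 0 z‖ := by
    simpa [hf.normalized.map_zero] using (congrArg norm (sub_smul_dslope f 0 z)).symm
  have hpos : 0 < ‖dslope f 0 z‖ := norm_pos_iff.2 (hf.dslope_ne_zero hz)
  rw [hψ.extremalStarlike_ofReal ⟨by linarith, by linarith⟩,
    hψ.extremalStarlike_ofReal ⟨by linarith, hz1⟩, ofReal_re, ofReal_re, neg_mul, neg_neg, hfz]
  exact ⟨mul_le_mul_of_nonneg_left
      ((Real.le_log_iff_exp_le hpos).1 (hf.le_log_norm_dslope hψ hz)) hnonneg,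
    mul_le_mul_of_nonneg_left ((Real.log_le_iff_le_exp hpos).1 (hf.log_norm_dslope_le hψ hz))
      hnonneg⟩

end MaMindaStarlike

theorem mainTheorem2 (ψ : ℂ → ℂ) (hψ : IsMaMinda ψ) (r : ℝ) (hr0 : 0 < r) (hr1 : r < 1)
    (z₁ z₂ : ℂ) (hz₁ : z₁ ∈ Metric.sphere (0 : ℂ) r) (hz₂ : z₂ ∈ Metric.sphere (0 : ℂ) r)
    (hmin : IsMinOn (fun z => ‖ψ z‖) (Metric.sphere (0 : ℂ) r) z₁)
    (hmax : IsMaxOn (fun z => ‖ψ z‖) (Metric.sphere (0 : ℂ) r) z₂) :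
    -- `f₀(r)` and `f₀(-r)` are real numbers
    (extremalStarlike ψ (r : ℂ)).im = 0 ∧ (extremalStarlike ψ (-r : ℂ)).im = 0 ∧
    ∀ f : ℂ → ℂ, MaMindaStarlike ψ f → ∀ z₀ : ℂ, ‖z₀‖ = r →
      ‖ψ z₁‖ * (-(extremalStarlike ψ (-r : ℂ)).re / r) ≤ ‖deriv f z₀‖ ∧
      ‖deriv f z₀‖ ≤ (extremalStarlike ψ (r : ℂ)).re / r * ‖ψ z₂‖ := by
  have hreal : ∀ x ∈ Ioo (-1 : ℝ) 1, (extremalStarlike ψ x).im = 0 := fun x hx => by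
    rw [hψ.extremalStarlike_ofReal hx, ofReal_im]
  rw [← ofReal_neg]
  refine ⟨hreal r ⟨by linarith, hr1⟩, hreal (-r) ⟨by linarith, by linarith⟩, ?_⟩
  rintro f hf z₀ rfl
  have hz₀ : z₀ ∈ ball (0 : ℂ) 1 := mem_ball_zero_iff.2 hr1
  have hne : z₀ ≠ 0 := norm_pos_iff.1 hr0
  obtain ⟨ζ, hζ, hquot⟩ := hf.exists_norm_le_mul_deriv_div_eq hz₀ hne
  have hderiv : ‖deriv f z₀‖ = ‖f z₀‖ / ‖z₀‖ * ‖ψ ζ‖ := by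
    have := hf.ne_zero z₀ hz₀ hne
    rw [← hquot, ← norm_div, ← norm_mul]
    congr 1
    field_simp
  have hψ_lower : ‖ψ z₁‖ ≤ ‖ψ ζ‖ := hψ.norm_le_of_isMinOn_sphere hr0 hr1 hmin hζ
  have hψ_upper : ‖ψ ζ‖ ≤ ‖ψ z₂‖ := hψ.norm_le_of_isMaxOn_sphere hr0 hr1 hmax hζ
  obtain ⟨hf_lower, hf_upper⟩ := hf.norm_mem_Icc_extremalStarlike hψ hz₀
  rw [hderiv, mul_comm ‖ψ z₁‖]
  constructor <;> gcongr
  exact (div_nonneg (norm_nonneg _) hr0.le).trans (div_le_div_of_nonneg_right hf_upper hr0.le)
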